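/- Say that a matrix $A\in\mathbb{R}^{n\times N}$ satisfies the restricted isometry property (RIP) of order $s$ with constant $\delta\in(0,1)$ if $$(1-\delta)\|z\|_2^2\le\|A_Tz\|_2^2\le(1+\delta)\|z\|_2^2$$ for all $T\subset\{1,\dots,N\}$ with $|T|\le s$ and all $z\in\mathbb{R}^{|T|}$, where $A_T$ consists of the columns of $A$ with index in $T$. For positive integers $k,l,d,e$ put $n=ld$, $N=ke$, and consider the truncated Toeplitz block matrix $$\Phi=\begin{pmatrix}\Phi_k&\Phi_{k-1}&\cdots&\Phi_2&\Phi_1\\ \Phi_{k+1}&\Phi_k&\cdots&\Phi_3&\Phi_2\\ \vdots&\vdots&\ddots&\ddots&\vdots\\ \Phi_{k+l-1}&\Phi_{k+l-2}&\cdots&\cdots&\Phi_l\end{pmatrix}\in\mathbb{R}^{n\times N},$$ with blocks $\Phi_1,\dots,\Phi_{k+l-1}\in\mathbb{R}^{d\times e}$, where the entries of all the blocks are mutually independent random variables with a common distribution, which is one of the following three: the normal distribution $N(0,1/n)$; the values $\pm1/\sqrt n$ with probability $1/2$ each; the values $\pm\sqrt{3/n}$ with probability $1/6$ each and $0$ with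 probability $2/3$. For every $\delta\in(0,1)$ there exist constants $c_1,c_2>0$ depending only on $\delta$ such that, for each of the three distributions and all positive integers $m,k,l,d,e$ with $3m\le N$, the following holds. (i) If $l\le 3m(3m-1)$ and $n\ge c_1\,l\,m\ln(N/m)$, then $\Phi$ satisfies RIP of order $3m$ with constant $\delta$ with probability at least $1-e^{-c_2n/l}$. (ii) If $l>3m(3m-1)$ and $n\ge c_1\,m^3\ln(N/m)$, then $\Phi$ satisfies RIP of order $3m$ with constant $\delta$ with probability at least $1-e^{-c_2n/m^2}$. -/

import Mathlib

open MeasureTheory ProbabilityTheory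
open scoped NNReal ENNReal

/-- The three admissible distributions of the entries of the random blocks. -/
inductive EntryDistribution where
  | gaussian
  | bernoulli
  | ternary

/-- The law of an entry of a matrix with `n` rows: the normal law `N(0, 1/n)`, or `±1/√n` with
probability `1/2` each, or `±√(3/n)` with probability `1/6` each and `0` with
probability `2/3`. -/
noncomputable def EntryDistribution.law (P : EntryDistribution) (n : ℕ) : Measure ℝ :=
  match P with
  | .gaussian => gaussianReal 0 (1 / (n : ℝ≥0))
  | .bernoulli =>
      (1 / 2 : ℝ≥0∞) • Measure.dirac (1 / √(n : ℝ)) +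
        (1 / 2 : ℝ≥0∞) • Measure.dirac (-(1 / √(n : ℝ)))
  | .ternary =>
      (1 / 6 : ℝ≥0∞) • Measure.dirac (√(3 / (n : ℝ))) +
        (2 / 3 : ℝ≥0∞) • Measure.dirac (0 : ℝ) +
        (1 / 6 : ℝ≥0∞) • Measure.dirac (-√(3 / (n : ℝ)))

/-- The truncated Toeplitz block matrix with `l` block rows and `k` block columns built from
the `d × e` blocks `B 0, …, B (k + l - 2)`. Counting everything from `0`, the block in
position `(i, j)` is `B (i + (k - 1 - j))`: the first block row is
`B (k - 1), …, B 1, B 0` and the last one is `B (k + l - 2), …, B (l - 1)`. -/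
def toeplitzBlock {k l d e : ℕ} (B : Fin (k + l - 1) → Matrix (Fin d) (Fin e) ℝ) :
    Matrix (Fin l × Fin d) (Fin k × Fin e) ℝ :=
  fun p q => B ⟨p.1 + (k - 1 - q.1), by have := p.1.isLt; have := q.1.isLt; omega⟩ p.2 q.2

/-- The restricted isometry property of order `s` with constant `δ`; the norms are
Euclidean and `A.submatrix id (↑)` retains the columns with index in `T`. -/
def SatisfiesRIP {ι κ : Type*} [Fintype ι] (A : Matrix ι κ ℝ) (s : ℕ) (δ : ℝ) : Prop :=
  ∀ T : Finset κ, T.card ≤ s → ∀ z : EuclideanSpace ℝ T,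
    (1 - δ) * ‖z‖ ^ 2 ≤
        ‖WithLp.toLp 2 ((A.submatrix id (fun t : T => (t : κ))).mulVec z.ofLp)‖ ^ 2 ∧
      ‖WithLp.toLp 2 ((A.submatrix id (fun t : T => (t : κ))).mulVec z.ofLp)‖ ^ 2 ≤
        (1 + δ) * ‖z‖ ^ 2

/-! A linear form of independent sub-Gaussian variables is sub-Gaussian, so its centred square is
sub-exponential: `exp (b y²)` is the moment generating function of a standard Gaussian variable, and
Fubini moves the sub-Gaussian bound under the Gaussian integral. Hence each coordinate of `Φ x` has
a square which concentrates, but different rows of `Φ` share random variables. Properly colour the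
graph joining the rows which share a variable: rows of equal colour are independent, and Hölder's
inequality combines `q` colours at the price of dividing the exponent by `q`. A union bound over a
`1/2`-net of the unit ball and over the supports of size `3m` turns the resulting deviation
inequality into the restricted isometry property.

In the Toeplitz pattern the position of a row inside its block row is determined by any of its
variables, so the `l` block rows are the classes of a proper colouring. On `3m` columns a row also
meets at most `3m (3m - 1)` others, so that greedy colouring needs only `3m (3m - 1) + 1 ≤ 9m²`
colours. -/

section SquareOfSubgaussian

variable {Ω : Type*} {mΩ : MeasurableSpace Ω} {μ : Measure Ω}

lemma integral_eq_zero_of_hasSubgaussianMGF [IsProbabilityMeasure μ] {Y : Ω → ℝ} {c : ℝ≥0}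
    (hY : HasSubgaussianMGF Y c μ) : ∫ ω, Y ω ∂μ = 0 := by
  have hY0 : (0 : ℝ) ∈ interior (integrableExpSet Y μ) := by
    simp [hY.integrableExpSet_eq_univ]
  have hmgf : HasDerivAt (mgf Y μ) (∫ ω, Y ω ∂μ) 0 := by
    simpa using hasDerivAt_mgf hY0
  have hexp : HasDerivAt (fun t : ℝ => Real.exp (c * t ^ 2 / 2)) 0 0 := by
    simpa using (((hasDerivAt_pow 2 (0 : ℝ)).const_mul (c : ℝ)).div_const 2).exp
  have hmax : IsLocalMax (fun t => mgf Y μ t - Real.exp (c * t ^ 2 / 2)) 0 :=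
    .of_forall fun t => by simpa using hY.mgf_le t
  simpa using hmax.hasDerivAt_eq_zero (hmgf.sub hexp)

lemma gaussianPDFReal_smul_exp_mul_sq (a x : ℝ) :
    gaussianPDFReal 0 1 x • Real.exp (a * x ^ 2) =
      (√(2 * Real.pi))⁻¹ * Real.exp (-(1 / 2 - a) * x ^ 2) := by
  simp only [gaussianPDFReal, NNReal.coe_one, mul_one, sub_zero, smul_eq_mul]
  rw [mul_assoc, ← Real.exp_add]
  ring_nf

lemma integrable_exp_mul_sq_gaussianReal {a : ℝ} (ha : a < 1 / 2) :
    Integrable (fun g : ℝ => Real.exp (a * g ^ 2)) (gaussianReal 0 1) := by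
  rw [gaussianReal_of_var_ne_zero 0 one_ne_zero,
    integrable_withDensity_iff_integrable_smul₀' (by fun_prop)
      (ae_of_all _ fun x => by simp [gaussianPDF])]
  simp only [toReal_gaussianPDF, gaussianPDFReal_smul_exp_mul_sq]
  exact (integrable_exp_neg_mul_sq (sub_pos.2 ha)).const_mul _

lemma integral_exp_mul_sq_gaussianReal (a : ℝ) :
    ∫ g, Real.exp (a * g ^ 2) ∂(gaussianReal 0 1) = (√(1 - 2 * a))⁻¹ := by
  rw [integral_gaussianReal_eq_integral_smul one_ne_zero]
  simp_rw [gaussianPDFReal_smul_exp_mul_sq]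
  rw [integral_const_mul, integral_gaussian, ← Real.sqrt_inv, ← Real.sqrt_inv,
    ← Real.sqrt_mul (by positivity)]
  congr 1
  have : 1 / 2 - a = (1 - 2 * a) / 2 := by ring
  rw [this]
  field_simp

lemma integral_exp_sqrt_mul_gaussianReal {b : ℝ} (hb : 0 ≤ b) (y : ℝ) :
    ∫ g, Real.exp (√(2 * b) * y * g) ∂(gaussianReal 0 1) = Real.exp (b * y ^ 2) := by
  have h := congrFun (mgf_fun_id_gaussianReal (μ := 0) (v := 1)) (√(2 * b) * y)
  rw [mgf] at h
  rw [h, mul_pow, Real.sq_sqrt (by positivity), NNReal.coe_one]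
  ring_nf

lemma lintegral_exp_mul_sq_le_of_hasSubgaussianMGF [SFinite μ] {Y : Ω → ℝ} {c : ℝ≥0}
    (hY : HasSubgaussianMGF Y c μ) {b : ℝ} (hb : 0 ≤ b) (hbc : b * c < 1 / 2) :
    ∫⁻ ω, ENNReal.ofReal (Real.exp (b * Y ω ^ 2)) ∂μ ≤
      ENNReal.ofReal (√(1 - 2 * (b * c)))⁻¹ := by
  have hYm : AEMeasurable Y μ := hY.aemeasurable
  calc ∫⁻ ω, ENNReal.ofReal (Real.exp (b * Y ω ^ 2)) ∂μ
      = ∫⁻ ω, ∫⁻ g, ENNReal.ofReal (Real.exp (√(2 * b) * Y ω * g)) ∂(gaussianReal 0 1) ∂μ := by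
        refine lintegral_congr fun ω => ?_
        rw [← integral_exp_sqrt_mul_gaussianReal hb, ofReal_integral_eq_lintegral_ofReal
          (integrable_exp_mul_gaussianReal _) (ae_of_all _ fun _ => (Real.exp_pos _).le)]
    _ = ∫⁻ g, ∫⁻ ω, ENNReal.ofReal (Real.exp (√(2 * b) * Y ω * g)) ∂μ ∂(gaussianReal 0 1) :=
        lintegral_lintegral_swap
          ((hYm.comp_fst.const_mul _).mul measurable_snd.aemeasurable).exp.ennreal_ofReal
    _ ≤ ∫⁻ g, ENNReal.ofReal (Real.exp (b * c * g ^ 2)) ∂(gaussianReal 0 1) := by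
        refine lintegral_mono fun g => ?_
        simp_rw [mul_right_comm (√(2 * b)) _ g]
        rw [← ofReal_integral_eq_lintegral_ofReal (hY.integrable_exp_mul _)
          (ae_of_all _ fun _ => (Real.exp_pos _).le)]
        refine ENNReal.ofReal_le_ofReal ((hY.mgf_le _).trans_eq ?_)
        rw [mul_pow, Real.sq_sqrt (by positivity)]
        ring_nf
    _ = ENNReal.ofReal (√(1 - 2 * (b * c)))⁻¹ := by
        rw [← integral_exp_mul_sq_gaussianReal, ofReal_integral_eq_lintegral_ofReal
          (integrable_exp_mul_sq_gaussianReal hbc) (ae_of_all _ fun _ => (Real.exp_pos _).le)]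

lemma integrable_exp_mul_sq_of_hasSubgaussianMGF [SFinite μ] {Y : Ω → ℝ} {c : ℝ≥0}
    (hY : HasSubgaussianMGF Y c μ) {b : ℝ} (hb : 0 ≤ b) (hbc : b * c < 1 / 2) :
    Integrable (fun ω => Real.exp (b * Y ω ^ 2)) μ := by
  refine ⟨((hY.aemeasurable.pow_const 2).const_mul _).exp.aestronglyMeasurable, ?_⟩
  rw [hasFiniteIntegral_iff_ofReal (ae_of_all _ fun _ => (Real.exp_pos _).le)]
  exact (lintegral_exp_mul_sq_le_of_hasSubgaussianMGF hY hb hbc).trans_lt ENNReal.ofReal_lt_top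

lemma integral_exp_mul_sq_le_of_hasSubgaussianMGF [SFinite μ] {Y : Ω → ℝ} {c : ℝ≥0}
    (hY : HasSubgaussianMGF Y c μ) {b : ℝ} (hb : 0 ≤ b) (hbc : b * c < 1 / 2) :
    ∫ ω, Real.exp (b * Y ω ^ 2) ∂μ ≤ (√(1 - 2 * (b * c)))⁻¹ := by
  have h := lintegral_exp_mul_sq_le_of_hasSubgaussianMGF hY hb hbc
  rwa [← ofReal_integral_eq_lintegral_ofReal
    (integrable_exp_mul_sq_of_hasSubgaussianMGF hY hb hbc)
    (ae_of_all _ fun _ => (Real.exp_pos _).le), ENNReal.ofReal_le_ofReal_iff (by positivity)] at h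

lemma one_add_mul_variance_le_of_hasSubgaussianMGF [IsProbabilityMeasure μ] {Y : Ω → ℝ}
    {c : ℝ≥0} (hY : HasSubgaussianMGF Y c μ) {b : ℝ} (hb : 0 ≤ b) (hbc : b * c < 1 / 2) :
    1 + b * Var[Y; μ] ≤ (√(1 - 2 * (b * c)))⁻¹ := by
  have hsq : Integrable (fun ω => b * Y ω ^ 2) μ := (hY.memLp 2).integrable_sq.const_mul b
  calc 1 + b * Var[Y; μ] = ∫ ω, (b * Y ω ^ 2 + 1) ∂μ := by
        rw [integral_add hsq (integrable_const 1), integral_const_mul,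
          variance_of_integral_eq_zero hY.aemeasurable (integral_eq_zero_of_hasSubgaussianMGF hY)]
        simp [add_comm]
    _ ≤ ∫ ω, Real.exp (b * Y ω ^ 2) ∂μ :=
        integral_mono (hsq.add (integrable_const 1))
          (integrable_exp_mul_sq_of_hasSubgaussianMGF hY hb hbc) fun ω => Real.add_one_le_exp _
    _ ≤ _ := integral_exp_mul_sq_le_of_hasSubgaussianMGF hY hb hbc

lemma variance_le_of_hasSubgaussianMGF [IsProbabilityMeasure μ] {Y : Ω → ℝ} {c : ℝ≥0}
    (hY : HasSubgaussianMGF Y c μ) : Var[Y; μ] ≤ 2 * c := by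
  obtain rfl | hc := eq_zero_or_pos c
  · simpa using one_add_mul_variance_le_of_hasSubgaussianMGF hY zero_le_one (by simp)
  have : (0 : ℝ) < c := hc
  have hbc : 1 / (4 * c) * c = (1 / 4 : ℝ) := by field_simp
  have h := one_add_mul_variance_le_of_hasSubgaussianMGF hY (b := 1 / (4 * c)) (by positivity)
    (by rw [hbc]; norm_num)
  have hsqrt : (√(1 - 2 * (1 / 4)))⁻¹ ≤ (3 / 2 : ℝ) :=
    inv_le_of_inv_le₀ (by norm_num) (Real.le_sqrt_of_sq_le (by norm_num))
  rw [hbc, one_div_mul_eq_div] at h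
  have hdiv : Var[Y; μ] / (4 * c) ≤ 1 / 2 := by linarith
  rw [div_le_iff₀ (by positivity)] at hdiv
  linarith

lemma exp_le_one_add_add_sq_mul_exp_abs (u : ℝ) :
    Real.exp u ≤ 1 + u + u ^ 2 * Real.exp |u| := by
  have htaylor : ‖(Real.exp u - (1 + u) : ℂ)‖ ≤ u ^ 2 * Real.exp |u| := by
    simpa [Finset.sum_range_succ] using Complex.norm_exp_sub_sum_le_norm_mul_exp u 2
  have hreal : ‖Real.exp u - (1 + u)‖ ≤ u ^ 2 * Real.exp |u| := by exact_mod_cast htaylor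
  linarith [Real.le_norm_self (Real.exp u - (1 + u))]

lemma exp_mul_sq_sub_le {c V θ : ℝ} (hc : 0 < c) (hV0 : 0 ≤ V) (hV : V ≤ 2 * c)
    (hθ : |θ| ≤ 1 / (8 * c)) (y : ℝ) :
    Real.exp (θ * (y ^ 2 - V)) ≤
      1 + θ * (y ^ 2 - V) + θ ^ 2 * (256 * c ^ 2 * Real.exp (1 / (4 * c) * y ^ 2)) := by
  set w := (y ^ 2 + V) / (8 * c)
  have hw0 : 0 ≤ w := by positivity
  have hdiff : |y ^ 2 - V| ≤ 8 * c * w := by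
    rw [mul_div_cancel₀ _ (by positivity)]
    exact abs_le.2 ⟨by linarith [sq_nonneg y], by linarith⟩
  have hlin : |θ * (y ^ 2 - V)| ≤ w := by
    rw [abs_mul]
    calc |θ| * |y ^ 2 - V| ≤ 1 / (8 * c) * (8 * c * w) := by gcongr
      _ = w := by field_simp
  have hquad : (y ^ 2 - V) ^ 2 ≤ 128 * c ^ 2 * Real.exp w := by
    have hexp : w ^ 2 / 2 ≤ Real.exp w := by
      simpa using Real.pow_div_factorial_le_exp w hw0 2
    calc (y ^ 2 - V) ^ 2 = |y ^ 2 - V| ^ 2 := (sq_abs _).symm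
      _ ≤ (8 * c * w) ^ 2 := by gcongr
      _ = 128 * c ^ 2 * (w ^ 2 / 2) := by ring
      _ ≤ 128 * c ^ 2 * Real.exp w := by gcongr
  have hexpV : Real.exp (V / (4 * c)) ≤ 2 := by
    refine (Real.exp_le_exp.2 ?_).trans ((Real.exp_log zero_lt_two).le)
    have : V / (4 * c) ≤ 1 / 2 := by rw [div_le_iff₀ (by positivity)]; linarith
    linarith [Real.log_two_gt_d9]
  refine (exp_le_one_add_add_sq_mul_exp_abs _).trans (add_le_add_right ?_ _)
  calc (θ * (y ^ 2 - V)) ^ 2 * Real.exp |θ * (y ^ 2 - V)|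
      ≤ θ ^ 2 * (128 * c ^ 2 * Real.exp w) * Real.exp w := by rw [mul_pow]; gcongr
    _ = 128 * c ^ 2 * θ ^ 2 * (Real.exp (V / (4 * c)) * Real.exp (1 / (4 * c) * y ^ 2)) := by
        have hww : V / (4 * c) + 1 / (4 * c) * y ^ 2 = w + w := by simp only [w]; field_simp; ring
        rw [← Real.exp_add, hww, Real.exp_add]
        ring
    _ ≤ 128 * c ^ 2 * θ ^ 2 * (2 * Real.exp (1 / (4 * c) * y ^ 2)) := by gcongr
    _ = _ := by ring

end SquareOfSubgaussian

/-- Sub-exponential random variables, in Bernstein's form: the moment generating function of `X`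
is dominated by `exp (a t²)` on the interval `|t| ≤ b`. -/
structure HasSubexponentialMGF {Ω : Type*} {mΩ : MeasurableSpace Ω} (X : Ω → ℝ) (a b : ℝ)
    (μ : Measure Ω) : Prop where
  aemeasurable : AEMeasurable X μ
  integrable_exp_mul : ∀ t, |t| ≤ b → Integrable (fun ω => Real.exp (t * X ω)) μ
  mgf_le : ∀ t, |t| ≤ b → mgf X μ t ≤ Real.exp (a * t ^ 2)

namespace HasSubexponentialMGF

variable {Ω : Type*} {mΩ : MeasurableSpace Ω} {μ : Measure Ω}

lemma of_exp_mul_le [IsProbabilityMeasure μ] {X G : Ω → ℝ} {a b : ℝ} (hX : Integrable X μ)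
    (hmean : ∫ ω, X ω ∂μ = 0) (hG : Integrable G μ) (hGa : ∫ ω, G ω ∂μ ≤ a)
    (hle : ∀ t, |t| ≤ b → ∀ ω, Real.exp (t * X ω) ≤ 1 + t * X ω + t ^ 2 * G ω) :
    HasSubexponentialMGF X a b μ := by
  have hlin (t : ℝ) : Integrable (fun ω => 1 + t * X ω) μ :=
    (integrable_const 1).add (hX.const_mul t)
  have hmajor (t : ℝ) : Integrable (fun ω => 1 + t * X ω + t ^ 2 * G ω) μ :=
    (hlin t).add (hG.const_mul _)
  have hint (t : ℝ) (ht : |t| ≤ b) : Integrable (fun ω => Real.exp (t * X ω)) μ :=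
    (hmajor t).mono' (hX.aemeasurable.const_mul t).exp.aestronglyMeasurable
      (ae_of_all _ fun ω => (Real.norm_of_nonneg (Real.exp_pos _).le).trans_le (hle t ht ω))
  refine ⟨hX.aemeasurable, hint, fun t ht => ?_⟩
  calc mgf X μ t ≤ ∫ ω, (1 + t * X ω + t ^ 2 * G ω) ∂μ :=
        integral_mono (hint t ht) (hmajor t) (hle t ht)
    _ = 1 + t ^ 2 * ∫ ω, G ω ∂μ := by
        rw [integral_add (hlin t) (hG.const_mul _),
          integral_add (integrable_const 1) (hX.const_mul t), integral_const_mul,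
          integral_const_mul, hmean]
        simp
    _ ≤ 1 + t ^ 2 * a := by gcongr
    _ ≤ Real.exp (a * t ^ 2) := by linarith [Real.add_one_le_exp (a * t ^ 2)]

lemma sq_sub_variance [IsProbabilityMeasure μ] {Y : Ω → ℝ} {c : ℝ≥0} (hc : 0 < c)
    (hY : HasSubgaussianMGF Y c μ) :
    HasSubexponentialMGF (fun ω => Y ω ^ 2 - Var[Y; μ]) (512 * c ^ 2) (1 / (8 * c)) μ := by
  have hbc : 1 / (4 * c) * c = (1 / 4 : ℝ) := by field_simp
  have hbc' : 1 / (4 * c) * c < (1 / 2 : ℝ) := by rw [hbc]; norm_num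
  have hsq : Integrable (fun ω => Y ω ^ 2) μ := (hY.memLp 2).integrable_sq
  have hsqrt : (√(1 - 2 * (1 / 4)))⁻¹ ≤ (2 : ℝ) :=
    inv_le_of_inv_le₀ (by norm_num) (Real.le_sqrt_of_sq_le (by norm_num))
  refine of_exp_mul_le (hsq.sub (integrable_const _)) ?_
    ((integrable_exp_mul_sq_of_hasSubgaussianMGF hY (b := 1 / (4 * c)) (by positivity)
      hbc').const_mul (256 * c ^ 2)) ?_
    fun t ht ω => exp_mul_sq_sub_le hc (variance_nonneg Y μ)
      (variance_le_of_hasSubgaussianMGF hY) ht (Y ω)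
  · rw [variance_of_integral_eq_zero hY.aemeasurable (integral_eq_zero_of_hasSubgaussianMGF hY),
      integral_sub hsq (integrable_const _)]
    simp
  · rw [integral_const_mul]
    calc (256 * c ^ 2 : ℝ) * ∫ ω, Real.exp (1 / (4 * c) * Y ω ^ 2) ∂μ
        ≤ 256 * c ^ 2 * (√(1 - 2 * (1 / (4 * c) * c)))⁻¹ := by
          gcongr
          exact integral_exp_mul_sq_le_of_hasSubgaussianMGF hY (by positivity) hbc'
      _ ≤ 256 * c ^ 2 * 2 := by rw [hbc]; gcongr
      _ = 512 * c ^ 2 := by ring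

lemma sum_of_iIndepFun {ι : Type*} [Fintype ι] {X : ι → Ω → ℝ} (hind : iIndepFun X μ) {a b : ℝ}
    (hX : ∀ i, HasSubexponentialMGF (X i) a b μ) :
    HasSubexponentialMGF (fun ω => ∑ i, X i ω) (Fintype.card ι * a) b μ := by
  have := hind.isProbabilityMeasure
  have hm (i : ι) := (hX i).aemeasurable
  have hmgf (t : ℝ) : mgf (fun ω => ∑ i, X i ω) μ t = ∏ i, mgf (X i) μ t := by
    rw [← hind.mgf_sum₀ hm]
    congr 1
    ext ω
    simp
  refine ⟨Finset.aemeasurable_fun_sum _ fun i _ => hm i, fun t ht => ?_, fun t ht => ?_⟩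
  · rw [← mgf_pos_iff, hmgf]
    exact Finset.prod_pos fun i _ => mgf_pos ((hX i).integrable_exp_mul t ht)
  · calc mgf (fun ω => ∑ i, X i ω) μ t = ∏ i, mgf (X i) μ t := hmgf t
      _ ≤ ∏ _i : ι, Real.exp (a * t ^ 2) :=
          Finset.prod_le_prod (fun i _ => mgf_nonneg) fun i _ => (hX i).mgf_le t ht
      _ = Real.exp (Fintype.card ι * a * t ^ 2) := by
          rw [Finset.prod_const, Finset.card_univ, ← Real.exp_nat_mul, mul_assoc]

lemma lintegral_exp_mul_le {X : Ω → ℝ} {a b t : ℝ} (hX : HasSubexponentialMGF X a b μ)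
    (ht : |t| ≤ b) :
    ∫⁻ ω, ENNReal.ofReal (Real.exp (t * X ω)) ∂μ ≤ ENNReal.ofReal (Real.exp (a * t ^ 2)) := by
  rw [← ofReal_integral_eq_lintegral_ofReal (hX.integrable_exp_mul t ht)
    (ae_of_all _ fun _ => (Real.exp_pos _).le)]
  exact ENNReal.ofReal_le_ofReal (hX.mgf_le t ht)

lemma of_lintegral_exp_mul_le {X : Ω → ℝ} {a b : ℝ} (hX : AEMeasurable X μ)
    (h : ∀ t, |t| ≤ b →
      ∫⁻ ω, ENNReal.ofReal (Real.exp (t * X ω)) ∂μ ≤ ENNReal.ofReal (Real.exp (a * t ^ 2))) :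
    HasSubexponentialMGF X a b μ := by
  have hint (t : ℝ) (ht : |t| ≤ b) : Integrable (fun ω => Real.exp (t * X ω)) μ := by
    refine ⟨(hX.const_mul t).exp.aestronglyMeasurable, ?_⟩
    rw [hasFiniteIntegral_iff_ofReal (ae_of_all _ fun _ => (Real.exp_pos _).le)]
    exact (h t ht).trans_lt ENNReal.ofReal_lt_top
  refine ⟨hX, hint, fun t ht => ?_⟩
  have hle := h t ht
  rwa [← ofReal_integral_eq_lintegral_ofReal (hint t ht) (ae_of_all _ fun _ => (Real.exp_pos _).le),
    ENNReal.ofReal_le_ofReal_iff (Real.exp_pos _).le] at hle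

lemma sum {ι : Type*} [Fintype ι] [Nonempty ι] {X : ι → Ω → ℝ} {a : ι → ℝ} {b : ℝ}
    (hX : ∀ i, HasSubexponentialMGF (X i) (a i) b μ) :
    HasSubexponentialMGF (fun ω => ∑ i, X i ω) (Fintype.card ι * ∑ i, a i)
      (b / Fintype.card ι) μ := by
  have hq : (0 : ℝ) < Fintype.card ι := by exact_mod_cast Fintype.card_pos
  have hm (i : ι) := (hX i).aemeasurable
  refine of_lintegral_exp_mul_le (Finset.aemeasurable_fun_sum _ fun i _ => hm i) fun t ht => ?_
  rw [le_div_iff₀ hq] at ht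
  have hθ : |t * Fintype.card ι| ≤ b := by rwa [abs_mul, abs_of_pos hq]
  have hroot (x : ℝ) : ENNReal.ofReal (Real.exp (t * Fintype.card ι * x)) ^
      (1 / (Fintype.card ι : ℝ)) = ENNReal.ofReal (Real.exp (t * x)) := by
    rw [ENNReal.ofReal_rpow_of_pos (Real.exp_pos _), ← Real.exp_mul]
    congr 2
    field_simp
  calc ∫⁻ ω, ENNReal.ofReal (Real.exp (t * ∑ i, X i ω)) ∂μ
      = ∫⁻ ω, ∏ i, ENNReal.ofReal (Real.exp (t * Fintype.card ι * X i ω)) ^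
          (1 / (Fintype.card ι : ℝ)) ∂μ := by
        refine lintegral_congr fun ω => ?_
        simp_rw [hroot]
        rw [← ENNReal.ofReal_prod_of_nonneg fun i _ => (Real.exp_pos _).le, ← Real.exp_sum,
          Finset.mul_sum]
    _ ≤ ∏ i, (∫⁻ ω, ENNReal.ofReal (Real.exp (t * Fintype.card ι * X i ω)) ∂μ) ^
          (1 / (Fintype.card ι : ℝ)) :=
        ENNReal.lintegral_prod_norm_pow_le _
          (fun i _ => ((hm i).const_mul _).exp.ennreal_ofReal) (by simp [hq.ne'])
          fun i _ => by positivity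
    _ ≤ ∏ i, ENNReal.ofReal (Real.exp (a i * (t * Fintype.card ι) ^ 2)) ^
          (1 / (Fintype.card ι : ℝ)) := by
        gcongr with i
        exact (hX i).lintegral_exp_mul_le hθ
    _ = ENNReal.ofReal (Real.exp (Fintype.card ι * (∑ i, a i) * t ^ 2)) := by
        have hexp (i : ι) : a i * (t * Fintype.card ι) ^ 2 =
            t * Fintype.card ι * (Fintype.card ι * a i * t) := by ring
        simp_rw [hexp, hroot]
        rw [← ENNReal.ofReal_prod_of_nonneg fun i _ => (Real.exp_pos _).le, ← Real.exp_sum,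
          ← Finset.mul_sum, ← Finset.sum_mul, ← Finset.mul_sum]
        ring_nf

lemma sum_of_coloring {R C : Type*} [Fintype R] [Fintype C] [Nonempty C] {X : R → Ω → ℝ}
    {a b : ℝ} (hX : ∀ r, HasSubexponentialMGF (X r) a b μ) (f : R → C)
    (hind : ∀ c, iIndepFun (fun r : {r // f r = c} => X r) μ) :
    HasSubexponentialMGF (fun ω => ∑ r, X r ω) (Fintype.card C * (Fintype.card R * a))
      (b / Fintype.card C) μ := by
  classical
  have hcard : ∑ c, (Fintype.card {r // f r = c} : ℝ) = Fintype.card R := by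
    exact_mod_cast (Fintype.card_sigma.symm.trans (Fintype.card_congr (Equiv.sigmaFiberEquiv f)))
  have h := sum fun c => sum_of_iIndepFun (hind c) fun r => hX r
  have hfiber (ω : Ω) : ∑ c, ∑ r : {r // f r = c}, X r ω = ∑ r, X r ω :=
    Fintype.sum_fiberwise f fun r => X r ω
  simpa only [hfiber, ← Finset.sum_mul, hcard] using h

lemma neg {X : Ω → ℝ} {a b : ℝ} (hX : HasSubexponentialMGF X a b μ) :
    HasSubexponentialMGF (-X) a b μ where
  aemeasurable := hX.aemeasurable.neg
  integrable_exp_mul t ht := by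
    simpa using hX.integrable_exp_mul (-t) (by rwa [abs_neg])
  mgf_le t ht := by
    simpa [mgf_neg] using hX.mgf_le (-t) (by rwa [abs_neg])

lemma measureReal_ge_le [IsFiniteMeasure μ] {X : Ω → ℝ} {a b ε : ℝ}
    (hX : HasSubexponentialMGF X a b μ) (ha : 0 < a) (hε : 0 ≤ ε) (hεb : ε ≤ 2 * a * b) :
    μ.real {ω | ε ≤ X ω} ≤ Real.exp (-(ε ^ 2 / (4 * a))) := by
  have ht : 0 ≤ ε / (2 * a) := by positivity
  have htb : |ε / (2 * a)| ≤ b := by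
    rw [abs_of_nonneg ht, div_le_iff₀ (by positivity)]
    linarith
  calc μ.real {ω | ε ≤ X ω} ≤ Real.exp (-(ε / (2 * a)) * ε) * mgf X μ (ε / (2 * a)) :=
        measure_ge_le_exp_mul_mgf ε ht (hX.integrable_exp_mul _ htb)
    _ ≤ Real.exp (-(ε / (2 * a)) * ε) * Real.exp (a * (ε / (2 * a)) ^ 2) := by
        gcongr
        exact hX.mgf_le _ htb
    _ = Real.exp (-(ε ^ 2 / (4 * a))) := by
        rw [← Real.exp_add]
        congr 1
        field_simp
        ring

lemma measureReal_abs_ge_le [IsFiniteMeasure μ] {X : Ω → ℝ} {a b ε : ℝ}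
    (hX : HasSubexponentialMGF X a b μ) (ha : 0 < a) (hε : 0 ≤ ε) (hεb : ε ≤ 2 * a * b) :
    μ.real {ω | ε ≤ |X ω|} ≤ 2 * Real.exp (-(ε ^ 2 / (4 * a))) := by
  have hunion : {ω | ε ≤ |X ω|} = {ω | ε ≤ X ω} ∪ {ω | ε ≤ (-X) ω} := by
    ext ω
    simp [le_abs]
  rw [hunion, two_mul]
  exact (measureReal_union_le _ _).trans (add_le_add (hX.measureReal_ge_le ha hε hεb)
    (hX.neg.measureReal_ge_le ha hε hεb))

end HasSubexponentialMGF

section LinearCombination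

variable {Ω T : Type*} {mΩ : MeasurableSpace Ω} {μ : Measure Ω} {ξ : T → Ω → ℝ}

lemma iIndepFun_mul_const (hind : iIndepFun ξ μ) (x : T → ℝ) :
    iIndepFun (fun t ω => ξ t ω * x t) μ :=
  hind.comp (fun t y => y * x t) fun _ => measurable_mul_const _

variable [Fintype T]

lemma hasSubgaussianMGF_sum_mul {c : ℝ≥0} (hind : iIndepFun ξ μ)
    (hsub : ∀ t, HasSubgaussianMGF (ξ t) c μ) (x : EuclideanSpace ℝ T) :
    HasSubgaussianMGF (fun ω => ∑ t, ξ t ω * x t) (c * ‖x‖₊ ^ 2) μ := by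
  have hterm (t : T) : HasSubgaussianMGF (fun ω => ξ t ω * x t) (‖x t‖₊ ^ 2 * c) μ := by
    have hsq : ‖x t‖₊ ^ 2 = ⟨x t ^ 2, sq_nonneg _⟩ := NNReal.eq (sq_abs (x t))
    simpa only [hsq, mul_comm (x t)] using (hsub t).const_mul (x t)
  have h := HasSubgaussianMGF.sum_of_iIndepFun (iIndepFun_mul_const hind x)
    (s := Finset.univ) fun t _ => hterm t
  have hnorm : ‖x‖₊ ^ 2 = ∑ t, ‖x t‖₊ ^ 2 :=
    NNReal.eq (by simp [EuclideanSpace.real_norm_sq_eq])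
  rwa [← Finset.sum_mul, ← hnorm, mul_comm] at h

lemma variance_sum_mul {v : ℝ} (hind : iIndepFun ξ μ) (hL : ∀ t, MemLp (ξ t) 2 μ)
    (hvar : ∀ t, Var[ξ t; μ] = v) (x : EuclideanSpace ℝ T) :
    Var[fun ω => ∑ t, ξ t ω * x t; μ] = v * ‖x‖ ^ 2 := by
  have hsum : (fun ω => ∑ t, ξ t ω * x t) = ∑ t, fun ω => ξ t ω * x t := by
    ext ω
    simp
  rw [hsum, IndepFun.variance_sum (fun t _ => (hL t).mul_const (x t)) fun t _ t' _ ht =>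
    (iIndepFun_mul_const hind x).indepFun ht, EuclideanSpace.real_norm_sq_eq, Finset.mul_sum]
  exact Finset.sum_congr rfl fun t _ => by rw [variance_mul_const, hvar]

end LinearCombination

lemma iIndepFun_curry {Ω ι κ : Type*} {mΩ : MeasurableSpace Ω} {μ : Measure Ω} [Countable ι]
    [Countable κ] {X : ι → κ → Ω → ℝ} (hX : ∀ i j, AEMeasurable (X i j) μ)
    (hind : iIndepFun (fun p : ι × κ => X p.1 p.2) μ) :
    iIndepFun (fun i ω j => X i j ω) μ := by
  have := hind.isProbabilityMeasure
  have (i : ι) (j : κ) : IsProbabilityMeasure (μ.map (X i j)) :=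
    Measure.isProbabilityMeasure_map (hX i j)
  have hcurry : (fun ω i j => X i j ω) =
      MeasurableEquiv.curry ι κ ℝ ∘ fun ω (p : ι × κ) => X p.1 p.2 ω := rfl
  rw [iIndepFun_iff_map_fun_eq_infinitePi_map₀' fun i => aemeasurable_pi_iff.2 (hX i), hcurry,
    ← AEMeasurable.map_map_of_aemeasurable (MeasurableEquiv.measurable _).aemeasurable
      (aemeasurable_pi_iff.2 fun p : ι × κ => hX p.1 p.2),
    hind.map_fun_eq_infinitePi_map₀' fun p : ι × κ => hX p.1 p.2,
    Measure.infinitePi_map_curry fun i j => μ.map (X i j)]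
  congr 1
  ext1 i
  have hrow : iIndepFun (X i) μ :=
    iIndepFun.precomp (g := fun j => (i, j)) (Prod.mk_right_injective i) hind
  exact (hrow.map_fun_eq_infinitePi_map₀' (hX i)).symm

section PatternMatrix

variable {Ω ι R T C : Type*}

/-- The matrix all of whose entries are taken from one family `x`, the entry in position
`(r, t)` being the member of `x` with index `φ r t`. Structured random matrices arise from it by
taking for `x` a family of independent random variables. -/
def patternMatrix (φ : R → T → ι) (x : ι → ℝ) : Matrix R T ℝ :=
  Matrix.of fun r t => x (φ r t)

/-- The graph on the rows of a pattern in which two rows are adjacent if some index occurs in both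
of them. Rows of equal colour in a proper colouring of it have no random variable in common. -/
def conflictGraph (φ : R → T → ι) : SimpleGraph R where
  Adj r r' := r ≠ r' ∧ ∃ t t', φ r t = φ r' t'
  symm := ⟨fun _ _ ⟨hne, t, t', h⟩ => ⟨hne.symm, t', t, h.symm⟩⟩
  loopless := ⟨fun _ h => h.1 rfl⟩

variable {φ : R → T → ι}

lemma injective_uncurry_of_coloring (hφ : ∀ r, Function.Injective (φ r))
    (f : (conflictGraph φ).Coloring C) (c : C) :
    Function.Injective fun p : {r // f r = c} × T => φ p.1 p.2 := by
  rintro ⟨⟨r, hr⟩, t⟩ ⟨⟨r', hr'⟩, t'⟩ h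
  obtain rfl : r = r' := by
    by_contra hne
    exact f.valid ⟨hne, t, t', h⟩ (hr.trans hr'.symm)
  exact Prod.ext rfl (hφ r h)

variable [Fintype R] [Fintype T] [Fintype C] {mΩ : MeasurableSpace Ω} {μ : Measure Ω}
  {ξ : ι → Ω → ℝ} {c : ℝ≥0} {v : ℝ}

lemma hasSubexponentialMGF_norm_sq_mulVec_patternMatrix [Nonempty C] (hind : iIndepFun ξ μ)
    (hc : 0 < c) (hsub : ∀ i, HasSubgaussianMGF (ξ i) c μ) (hvar : ∀ i, Var[ξ i; μ] = v)
    (hφ : ∀ r, Function.Injective (φ r)) (f : (conflictGraph φ).Coloring C)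
    {x : EuclideanSpace ℝ T} (hx : x ≠ 0) :
    HasSubexponentialMGF
      (fun ω => ‖WithLp.toLp 2 ((patternMatrix φ (ξ · ω)).mulVec x.ofLp)‖ ^ 2 -
        Fintype.card R * (v * ‖x‖ ^ 2))
      (Fintype.card C * (Fintype.card R * (512 * (c * ‖x‖ ^ 2) ^ 2)))
      (1 / (8 * (c * ‖x‖ ^ 2)) / Fintype.card C) μ := by
  have := hind.isProbabilityMeasure
  have hrow (r : R) : HasSubexponentialMGF
      (fun ω => (∑ t, ξ (φ r t) ω * x t) ^ 2 - v * ‖x‖ ^ 2) (512 * (c * ‖x‖ ^ 2) ^ 2)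
      (1 / (8 * (c * ‖x‖ ^ 2))) μ := by
    have hindr : iIndepFun (fun t => ξ (φ r t)) μ := hind.precomp (hφ r)
    have h := HasSubexponentialMGF.sq_sub_variance (mul_pos hc (pow_pos (nnnorm_pos.2 hx) 2))
      (hasSubgaussianMGF_sum_mul hindr (fun t => hsub _) x)
    rw [variance_sum_mul hindr (fun t => (hsub _).memLp 2) (fun t => hvar _)] at h
    simpa using h
  have hclass (b : C) : iIndepFun
      (fun (r : {r // f r = b}) ω => (∑ t, ξ (φ r t) ω * x t) ^ 2 - v * ‖x‖ ^ 2) μ :=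
    (iIndepFun_curry (fun _ _ => (hsub _).aemeasurable)
      (hind.precomp (injective_uncurry_of_coloring hφ f b))).comp
      (fun _ y => (∑ t, y t * x t) ^ 2 - v * ‖x‖ ^ 2) fun _ => by fun_prop
  convert HasSubexponentialMGF.sum_of_coloring hrow f hclass using 2 with ω
  rw [EuclideanSpace.real_norm_sq_eq, Finset.sum_sub_distrib, Finset.sum_const, nsmul_eq_mul,
    Finset.card_univ]
  rfl

lemma measureReal_norm_sq_mulVec_patternMatrix_deviation_le [Nonempty R] [Nonempty C]
    (hind : iIndepFun ξ μ) (hc : 0 < c) (hsub : ∀ i, HasSubgaussianMGF (ξ i) c μ)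
    (hvar : ∀ i, Var[ξ i; μ] = v) (hφ : ∀ r, Function.Injective (φ r))
    (f : (conflictGraph φ).Coloring C) (x : EuclideanSpace ℝ T) {η : ℝ} (hη0 : 0 ≤ η)
    (hη : η ≤ 128) :
    μ.real {ω | Fintype.card R * (η * c * ‖x‖ ^ 2) <
        |‖WithLp.toLp 2 ((patternMatrix φ (ξ · ω)).mulVec x.ofLp)‖ ^ 2 -
          Fintype.card R * (v * ‖x‖ ^ 2)|} ≤
      2 * Real.exp (-(η ^ 2 * Fintype.card R / (2048 * Fintype.card C))) := by
  have := hind.isProbabilityMeasure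
  rcases eq_or_ne x 0 with rfl | hx
  · simpa using Real.exp_nonneg _
  have hR : (0 : ℝ) < Fintype.card R := by exact_mod_cast Fintype.card_pos
  have : (0 : ℝ) < Fintype.card C := by exact_mod_cast Fintype.card_pos
  have hc' : (0 : ℝ) < c := hc
  have hx' : 0 < ‖x‖ := norm_pos_iff.2 hx
  have hdev := (hasSubexponentialMGF_norm_sq_mulVec_patternMatrix hind hc hsub hvar hφ f
    hx).measureReal_abs_ge_le (ε := Fintype.card R * (η * c * ‖x‖ ^ 2)) (by positivity)
    (by positivity) (by
      field_simp
      linarith)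
  refine (measureReal_mono (Set.ofPred_subset_ofPred.2 fun _ => le_of_lt)).trans (hdev.trans_eq ?_)
  congr 3
  field_simp
  ring

end PatternMatrix

section GreedyColoring

lemma colorable_of_forall_degree_le {V : Type*} [Fintype V] {G : SimpleGraph V}
    [DecidableRel G.Adj] {D : ℕ} (h : ∀ v, G.degree v ≤ D) : G.Colorable (D + 1) := by
  classical
  suffices hcol : ∀ s : Finset V, ∃ f : V → Fin (D + 1), ∀ v ∈ s, ∀ w ∈ s, G.Adj v w → f v ≠ f w by
    obtain ⟨f, hf⟩ := hcol Finset.univ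
    exact ⟨SimpleGraph.Coloring.mk f fun {v w} => hf v (Finset.mem_univ v) w (Finset.mem_univ w)⟩
  intro s
  induction s using Finset.induction_on with
  | empty => exact ⟨fun _ => 0, by simp⟩
  | insert u s hu ih =>
    obtain ⟨f, hf⟩ := ih
    obtain ⟨b, -, hb⟩ := Finset.exists_mem_notMem_of_card_lt_card
      (s := (G.neighborFinset u).image f) (t := Finset.univ) <| by
        rw [Finset.card_univ, Fintype.card_fin]
        exact Nat.lt_succ_of_le (Finset.card_image_le.trans (h u))
    have hnew (w : V) (hw : G.Adj u w) : b ≠ f w := by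
      rintro rfl
      exact hb (Finset.mem_image_of_mem f (by simpa using hw))
    have hold {v : V} (hv : v ∈ s) : Function.update f u b v = f v :=
      Function.update_of_ne (by rintro rfl; exact hu hv) _ _
    refine ⟨Function.update f u b, fun v hv w hw hvw => ?_⟩
    rcases Finset.mem_insert.1 hv with rfl | hvs <;> rcases Finset.mem_insert.1 hw with rfl | hws
    · exact absurd hvw G.irrefl
    · rw [Function.update_self, hold hws]
      exact hnew w hvw
    · rw [Function.update_self, hold hvs]
      exact (hnew v hvw.symm).symm
    · rw [hold hvs, hold hws]
      exact hf v hvs w hws hvw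

lemma conflictGraph_colorable {ι R T : Type*} [Finite R] [Fintype T] {φ : R → T → ι}
    (hφ : ∀ t, Function.Injective (φ · t)) :
    (conflictGraph φ).Colorable (Fintype.card T * (Fintype.card T - 1) + 1) := by
  classical
  have := Fintype.ofFinite R
  refine colorable_of_forall_degree_le fun r => ?_
  rw [← SimpleGraph.card_neighborFinset_eq_degree, Nat.mul_sub_one, ← Finset.card_univ,
    ← Finset.offDiag_card]
  refine Finset.card_le_card_of_forall_subsingleton
    (fun r' (p : T × T) => φ r p.1 = φ r' p.2) (fun r' hr' => ?_)
    fun p _ r₁ h₁ r₂ h₂ => hφ p.2 (h₁.2.symm.trans h₂.2)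
  obtain ⟨hne, t, t', h⟩ := (SimpleGraph.mem_neighborFinset _ _ _).1 hr'
  refine ⟨(t, t'), Finset.mem_offDiag.2 ⟨Finset.mem_univ _, Finset.mem_univ _, ?_⟩, h⟩
  rintro (rfl : t = t')
  exact hne (hφ t h)

end GreedyColoring

section Net

open Metric

variable {E F : Type*}

lemma card_le_of_isSeparated_half [NormedAddCommGroup E] [NormedSpace ℝ E] [FiniteDimensional ℝ E]
    {s : Finset E} (hs : (s : Set E) ⊆ closedBall 0 1)
    (hsep : IsSeparated (1 / 2 : ℝ≥0) (s : Set E)) :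
    s.card ≤ 5 ^ Module.finrank ℝ E := by
  classical
  have hinj : Function.Injective fun x : E => (2 : ℝ) • x := smul_right_injective E two_ne_zero
  rw [← Finset.card_image_of_injective s hinj]
  refine Besicovitch.card_le_of_separated _ (Finset.forall_mem_image.2 fun x hx => ?_)
    (Finset.forall_mem_image.2 fun x hx => Finset.forall_mem_image.2 fun y hy hxy => ?_)
  · rw [norm_smul, Real.norm_two]
    linarith [mem_closedBall_zero_iff.1 (hs hx)]
  · have hdist : 1 / 2 < ‖x - y‖ := by
      have h : ((1 / 2 : ℝ≥0) : ℝ≥0∞) < edist x y := hsep hx hy (ne_of_apply_ne _ hxy)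
      rw [edist_nndist, ENNReal.coe_lt_coe, ← NNReal.coe_lt_coe] at h
      simpa [dist_eq_norm] using h
    rw [← smul_sub, norm_smul, Real.norm_two]
    linarith

lemma packingNumber_half_closedBall_le [NormedAddCommGroup E] [NormedSpace ℝ E]
    [FiniteDimensional ℝ E] :
    packingNumber (1 / 2) (closedBall (0 : E) 1) ≤ (5 ^ Module.finrank ℝ E : ℕ) := by
  refine iSup₂_le fun C hC => iSup_le fun hsep => ?_
  by_contra! hcard
  obtain ⟨D, hDC, hD⟩ := Set.exists_subset_encard_eq (Order.add_one_le_of_lt hcard)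
  have hfin : D.Finite := Set.finite_of_encard_eq_coe hD
  have hle := card_le_of_isSeparated_half (s := hfin.toFinset) (by simpa using hDC.trans hC)
    (by simpa using hsep.subset hDC)
  rw [hfin.encard_eq_coe_toFinset_card] at hD
  have : hfin.toFinset.card = 5 ^ Module.finrank ℝ E + 1 := by exact_mod_cast hD
  omega

lemma exists_finset_isCover_closedBall [NormedAddCommGroup E] [NormedSpace ℝ E]
    [FiniteDimensional ℝ E] :
    ∃ s : Finset E, s.card ≤ 5 ^ Module.finrank ℝ E ∧ (s : Set E) ⊆ closedBall 0 1 ∧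
      IsCover (1 / 2) (closedBall 0 1) (s : Set E) := by
  have hpack := packingNumber_half_closedBall_le (E := E)
  have htop : packingNumber (1 / 2) (closedBall (0 : E) 1) ≠ ⊤ :=
    (hpack.trans_lt (ENat.natCast_lt_top _)).ne
  have hcard := encard_maximalSeparatedSet htop
  obtain ⟨s, hs⟩ := (Set.encard_lt_top_iff.1 (hcard.trans_lt htop.lt_top)).exists_finset_coe
  rw [← hs, Set.encard_coe_eq_coe_finsetCard] at hcard
  refine ⟨s, by exact_mod_cast hcard.trans_le hpack, ?_, ?_⟩ <;> rw [hs]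
  · exact maximalSeparatedSet_subset
  · exact isCover_maximalSeparatedSet htop

variable [NormedAddCommGroup E] [InnerProductSpace ℝ E]

-- The parallelogram law beats the triangle inequality, whose bound `1` would be of no use for
-- a `1 / 2`-net.
lemma norm_add_mul_norm_sub_le {x y : E} (hx : ‖x‖ ≤ 1) (hy : ‖y‖ ≤ 1) (hxy : ‖x - y‖ ≤ 1 / 2) :
    ‖x + y‖ * ‖x - y‖ ≤ 31 / 32 := by
  have hx2 : ‖x‖ ^ 2 ≤ 1 := pow_le_one₀ (norm_nonneg x) hx
  have hy2 : ‖y‖ ^ 2 ≤ 1 := pow_le_one₀ (norm_nonneg y) hy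
  have hxy2 : ‖x - y‖ ^ 2 ≤ 1 / 4 := by
    linarith [pow_le_pow_left₀ (norm_nonneg (x - y)) hxy 2]
  have hadd : ‖x + y‖ ^ 2 ≤ 4 - ‖x - y‖ ^ 2 := by
    linarith [parallelogram_law_with_norm ℝ x y]
  refine le_of_sq_le_sq ?_ (by norm_num)
  calc (‖x + y‖ * ‖x - y‖) ^ 2 = ‖x + y‖ ^ 2 * ‖x - y‖ ^ 2 := mul_pow _ _ _
    _ ≤ (4 - ‖x - y‖ ^ 2) * ‖x - y‖ ^ 2 := by gcongr
    _ ≤ (31 / 32) ^ 2 := by nlinarith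

lemma norm_le_of_abs_inner_le_on_cover {T : E →L[ℝ] E} (hT : T.IsSymmetric) {s : Set E}
    (hcover : IsCover (1 / 2) (closedBall 0 1) s) (hs : s ⊆ closedBall 0 1) {η : ℝ}
    (h : ∀ v ∈ s, |inner ℝ (T v) v| ≤ η) : ‖T‖ ≤ 32 * η := by
  have hball {x : E} (hx : ‖x‖ ≤ 1) : |inner ℝ (T x) x| ≤ η + 31 / 32 * ‖T‖ := by
    obtain ⟨v, hv, hxv⟩ := hcover (mem_closedBall_zero_iff.2 hx)
    have hv1 : ‖v‖ ≤ 1 := mem_closedBall_zero_iff.1 (hs hv)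
    have hxv' : ‖x - v‖ ≤ 1 / 2 := by
      rw [← dist_eq_norm]
      exact_mod_cast NNReal.coe_le_coe.2 (edist_le_coe.1 hxv)
    have hdiff : inner ℝ (T x) x = inner ℝ (T v) v + inner ℝ (T (x - v)) (x + v) := by
      have hsymm : inner ℝ (T x) v = inner ℝ (T v) x := (hT x v).trans (real_inner_comm _ _)
      rw [map_sub, inner_sub_left, inner_add_right, inner_add_right, hsymm]
      ring
    calc |inner ℝ (T x) x| ≤ |inner ℝ (T v) v| + ‖T (x - v)‖ * ‖x + v‖ := by
          rw [hdiff]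
          exact (abs_add_le _ _).trans (add_le_add_right (abs_real_inner_le_norm _ _) _)
      _ ≤ η + ‖T‖ * ‖x - v‖ * ‖x + v‖ := by
          gcongr
          exacts [h v hv, T.le_opNorm _]
      _ = η + ‖x + v‖ * ‖x - v‖ * ‖T‖ := by ring
      _ ≤ η + 31 / 32 * ‖T‖ := by
          gcongr
          exact norm_add_mul_norm_sub_le hx hv1 hxv'
  suffices hsup : ‖T‖ ≤ η + 31 / 32 * ‖T‖ by linarith
  refine (T.norm_eq_iSup_rayleighQuotient hT).trans_le (ciSup_le fun x => ?_)
  have hunit : ‖‖x‖⁻¹ • x‖ ≤ 1 := by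
    rw [norm_smul, norm_inv, norm_norm]
    exact inv_mul_le_one
  have hquot : T.rayleighQuotient x = inner ℝ (T (‖x‖⁻¹ • x)) (‖x‖⁻¹ • x) := by
    rw [map_smul, real_inner_smul_left, real_inner_smul_right]
    change inner ℝ (T x) x / ‖x‖ ^ 2 = _
    ring
  exact hquot ▸ hball hunit

lemma abs_norm_sq_sub_norm_sq_le_of_cover [CompleteSpace E] [NormedAddCommGroup F]
    [InnerProductSpace ℝ F] [CompleteSpace F] (L : E →L[ℝ] F) {s : Set E}
    (hcover : IsCover (1 / 2) (closedBall 0 1) s) (hs : s ⊆ closedBall 0 1) {η : ℝ}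
    (h : ∀ v ∈ s, |‖L v‖ ^ 2 - ‖v‖ ^ 2| ≤ η) (z : E) :
    |‖L z‖ ^ 2 - ‖z‖ ^ 2| ≤ 32 * η * ‖z‖ ^ 2 := by
  let T : E →L[ℝ] E := L.adjoint ∘L L - ContinuousLinearMap.id ℝ E
  have hinner (v : E) : inner ℝ (T v) v = ‖L v‖ ^ 2 - ‖v‖ ^ 2 := by
    simp [T, inner_sub_left, ContinuousLinearMap.adjoint_inner_left]
  have hT : T.IsSymmetric := fun x y => by
    simp [T, inner_sub_left, inner_sub_right, ContinuousLinearMap.adjoint_inner_left,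
      ContinuousLinearMap.adjoint_inner_right]
  have hnorm := norm_le_of_abs_inner_le_on_cover hT hcover hs fun v hv => by
    rw [hinner]
    exact h v hv
  calc |‖L z‖ ^ 2 - ‖z‖ ^ 2| = |inner ℝ (T z) z| := by rw [hinner]
    _ ≤ ‖T z‖ * ‖z‖ := abs_real_inner_le_norm _ _
    _ ≤ ‖T‖ * ‖z‖ * ‖z‖ := by
        gcongr
        exact T.le_opNorm z
    _ ≤ 32 * η * ‖z‖ ^ 2 := by
        rw [mul_assoc, ← sq]
        gcongr

end Net

section RestrictedIsometry

variable {ι κ τ : Type*} [Fintype κ] [Fintype τ]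

lemma mulVec_extend (A : Matrix ι κ ℝ) {g : τ → κ} (hg : Function.Injective g) (z : τ → ℝ) :
    A.mulVec (Function.extend g z 0) = (A.submatrix id g).mulVec z := by
  ext i
  refine (Fintype.sum_of_injective g hg _ _ (fun t ht => ?_) fun t => ?_).symm
  · simp [Function.extend_apply' _ _ _ ht]
  · simp [hg.extend_apply]

lemma norm_toLp_extend {g : τ → κ} (hg : Function.Injective g) (z : τ → ℝ) :
    ‖(WithLp.toLp 2 (Function.extend g z 0) : EuclideanSpace ℝ κ)‖ =
      ‖(WithLp.toLp 2 z : EuclideanSpace ℝ τ)‖ := by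
  rw [← sq_eq_sq₀ (norm_nonneg _) (norm_nonneg _), EuclideanSpace.real_norm_sq_eq,
    EuclideanSpace.real_norm_sq_eq]
  refine (Fintype.sum_of_injective g hg _ _ (fun t ht => ?_) fun t => ?_).symm
  · simp [Function.extend_apply' _ _ _ ht]
  · simp [hg.extend_apply]

lemma satisfiesRIP_of_card_eq [Fintype ι] {A : Matrix ι κ ℝ} {s : ℕ} {δ : ℝ}
    (hs : s ≤ Fintype.card κ)
    (h : ∀ T : Finset κ, T.card = s → ∀ z : EuclideanSpace ℝ T,
      |‖WithLp.toLp 2 ((A.submatrix id (fun t : T => (t : κ))).mulVec z.ofLp)‖ ^ 2 - ‖z‖ ^ 2| ≤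
        δ * ‖z‖ ^ 2) :
    SatisfiesRIP A s δ := by
  intro T hT z
  obtain ⟨T', hTT', hT'⟩ := Finset.exists_superset_card_eq hT hs
  have hg : Function.Injective (Set.inclusion hTT') := Set.inclusion_injective hTT'
  have hz : |‖WithLp.toLp 2 ((A.submatrix id (fun t : T => (t : κ))).mulVec z.ofLp)‖ ^ 2 -
      ‖z‖ ^ 2| ≤ δ * ‖z‖ ^ 2 := by
    have hext := h T' hT' (WithLp.toLp 2 (Function.extend (Set.inclusion hTT') z.ofLp 0))
    rw [mulVec_extend _ hg, norm_toLp_extend hg, Matrix.submatrix_submatrix] at hext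
    exact hext
  rw [abs_le] at hz
  exact ⟨by linarith [hz.1], by linarith [hz.2]⟩

end RestrictedIsometry

section Concentration

variable {Ω ι κ R T : Type*} [Fintype κ] [Fintype R] [Fintype T] [Nonempty R]
  {mΩ : MeasurableSpace Ω} {μ : Measure Ω} {ξ : ι → Ω → ℝ} {K : ℝ≥0} {δ : ℝ}

/-- The exponential rate, per row and per colour, at which a pattern matrix with normalised
`K`-sub-Gaussian entries fails to be a `δ`-isometry on a fixed set of columns: the factor `1 / 2048`
of the deviation bound for a single vector, taken at the deviation `δ / 32` which the passage from
a `1 / 2`-net to the whole space allows. -/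
noncomputable def concentrationRate (δ K : ℝ) : ℝ :=
  δ ^ 2 / (2 ^ 21 * K ^ 2)

lemma concentrationRate_pos {δ K : ℝ} (hδ : δ ≠ 0) (hK : K ≠ 0) : 0 < concentrationRate δ K := by
  rw [concentrationRate]
  positivity

lemma measureReal_abs_norm_sq_sub_norm_sq_gt_le (hind : iIndepFun ξ μ) (hK : 1 ≤ K)
    (hsub : ∀ i, HasSubgaussianMGF (ξ i) (K / Fintype.card R) μ)
    (hvar : ∀ i, Var[ξ i; μ] = 1 / Fintype.card R) {φ : R → T → ι}
    (hφ : ∀ r, Function.Injective (φ r)) {q : ℕ} (hq : (conflictGraph φ).Colorable q)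
    (hδ0 : 0 ≤ δ) (hδ1 : δ ≤ 1) (x : EuclideanSpace ℝ T) :
    μ.real {ω | δ / 32 * ‖x‖ ^ 2 <
        |‖WithLp.toLp 2 ((patternMatrix φ (ξ · ω)).mulVec x.ofLp)‖ ^ 2 - ‖x‖ ^ 2|} ≤
      2 * Real.exp (-(concentrationRate δ K * Fintype.card R / q)) := by
  obtain ⟨f⟩ := hq
  have : Nonempty (Fin q) := ⟨f (Classical.arbitrary R)⟩
  have : (0 : ℝ) < Fintype.card R := by exact_mod_cast Fintype.card_pos
  have : (1 : ℝ) ≤ K := hK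
  have hη : δ / (32 * K) ≤ 128 := (div_le_iff₀ (by positivity)).2 (by linarith)
  have h := measureReal_norm_sq_mulVec_patternMatrix_deviation_le hind (by positivity) hsub hvar
    hφ f x (by positivity) hη
  have hdev : Fintype.card R * (δ / (32 * K) * (K / Fintype.card R : ℝ≥0) * ‖x‖ ^ 2) =
      δ / 32 * ‖x‖ ^ 2 := by
    push_cast
    field_simp
  have hmean : Fintype.card R * (1 / Fintype.card R * ‖x‖ ^ 2) = ‖x‖ ^ 2 := by field_simp
  have hrate : (δ / (32 * K)) ^ 2 * Fintype.card R / (2048 * Fintype.card (Fin q)) =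
      concentrationRate δ K * Fintype.card R / q := by
    rw [concentrationRate, Fintype.card_fin]
    field_simp
    ring
  rwa [hdev, hmean, hrate] at h

lemma measureReal_not_forall_abs_norm_sq_sub_norm_sq_le (hind : iIndepFun ξ μ) (hK : 1 ≤ K)
    (hsub : ∀ i, HasSubgaussianMGF (ξ i) (K / Fintype.card R) μ)
    (hvar : ∀ i, Var[ξ i; μ] = 1 / Fintype.card R) {φ : R → T → ι}
    (hφ : ∀ r, Function.Injective (φ r)) {q : ℕ} (hq : (conflictGraph φ).Colorable q)
    (hδ0 : 0 ≤ δ) (hδ1 : δ ≤ 1) :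
    μ.real {ω | ¬∀ z : EuclideanSpace ℝ T,
        |‖WithLp.toLp 2 ((patternMatrix φ (ξ · ω)).mulVec z.ofLp)‖ ^ 2 - ‖z‖ ^ 2| ≤
          δ * ‖z‖ ^ 2} ≤
      5 ^ Fintype.card T * (2 * Real.exp (-(concentrationRate δ K * Fintype.card R / q))) := by
  have := hind.isProbabilityMeasure
  obtain ⟨s, hcard, hs, hcover⟩ := exists_finset_isCover_closedBall (E := EuclideanSpace ℝ T)
  rw [finrank_euclideanSpace] at hcard
  let bad (v : EuclideanSpace ℝ T) : Set Ω := {ω | δ / 32 * ‖v‖ ^ 2 <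
    |‖WithLp.toLp 2 ((patternMatrix φ (ξ · ω)).mulVec v.ofLp)‖ ^ 2 - ‖v‖ ^ 2|}
  have hgood {ω : Ω} (hω : ω ∉ ⋃ v ∈ s, bad v) (z : EuclideanSpace ℝ T) :
      |‖WithLp.toLp 2 ((patternMatrix φ (ξ · ω)).mulVec z.ofLp)‖ ^ 2 - ‖z‖ ^ 2| ≤
        δ * ‖z‖ ^ 2 := by
    classical
    let L := (patternMatrix φ (ξ · ω)).toEuclideanLin.toContinuousLinearMap
    have hnet (v) (hv : v ∈ (s : Set (EuclideanSpace ℝ T))) :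
        |‖L v‖ ^ 2 - ‖v‖ ^ 2| ≤ δ / 32 := by
      have hv1 : ‖v‖ ^ 2 ≤ 1 :=
        pow_le_one₀ (norm_nonneg v) (mem_closedBall_zero_iff.1 (hs hv))
      refine (le_of_not_gt fun hlt => hω (Set.mem_biUnion hv hlt)).trans ?_
      exact mul_le_of_le_one_right (by positivity) hv1
    have h := abs_norm_sq_sub_norm_sq_le_of_cover L hcover hs hnet z
    rwa [mul_div_cancel₀ δ (by norm_num)] at h
  calc _ ≤ μ.real (⋃ v ∈ s, bad v) :=
        measureReal_mono (fun ω (hω : ¬_) => by_contra fun hω' => hω (hgood hω'))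
          (measure_ne_top _ _)
    _ ≤ ∑ v ∈ s, μ.real (bad v) := measureReal_biUnion_finset_le _ _
    _ ≤ s.card • (2 * Real.exp (-(concentrationRate δ K * Fintype.card R / q))) :=
        Finset.sum_le_card_nsmul _ _ _ fun v _ =>
          measureReal_abs_norm_sq_sub_norm_sq_gt_le hind hK hsub hvar hφ hq hδ0 hδ1 v
    _ ≤ _ := by
        rw [nsmul_eq_mul]
        gcongr
        exact_mod_cast hcard

lemma choose_mul_five_pow_le_exp {N s : ℕ} (hs : 0 < s) (hN : s ≤ N) :
    N.choose s * (5 ^ s * 2 : ℝ) ≤ Real.exp (s * (4 + Real.log (N / s))) := by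
  have hs' : (0 : ℝ) < s := by exact_mod_cast hs
  have hN' : (0 : ℝ) < N := by exact_mod_cast hs.trans_le hN
  have hchoose : (N.choose s : ℝ) ≤ Real.exp (s * (1 + Real.log (N / s))) := by
    calc (N.choose s : ℝ) ≤ N ^ s / s.factorial := Nat.choose_le_pow_div s N
      _ = (N / s) ^ s * (s ^ s / s.factorial) := by
          rw [div_pow, div_mul_div_cancel₀ (by positivity)]
      _ ≤ (N / s) ^ s * Real.exp s := by
          gcongr
          exact Real.pow_div_factorial_le_exp _ hs'.le s
      _ = Real.exp (s * (1 + Real.log (N / s))) := by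
          rw [mul_add, Real.exp_add, mul_one, mul_comm, Real.exp_nat_mul (Real.log _),
            Real.exp_log (by positivity)]
  have hnet : (5 ^ s * 2 : ℝ) ≤ Real.exp (s * 3) := by
    have he : (10 : ℝ) ≤ Real.exp 3 := by
      rw [show (3 : ℝ) = (3 : ℕ) from rfl, ← Real.exp_one_pow]
      exact (by norm_num : (10 : ℝ) ≤ 2.7182818283 ^ 3).trans
        (pow_le_pow_left₀ (by norm_num) Real.exp_one_gt_d9.le 3)
    calc (5 ^ s * 2 : ℝ) ≤ 5 ^ s * 2 ^ s := by
          gcongr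
          exact le_self_pow₀ one_le_two hs.ne'
      _ = 10 ^ s := by rw [← mul_pow]; norm_num
      _ ≤ Real.exp 3 ^ s := by gcongr
      _ = Real.exp (s * 3) := (Real.exp_nat_mul 3 s).symm
  calc N.choose s * (5 ^ s * 2 : ℝ)
      ≤ Real.exp (s * (1 + Real.log (N / s))) * Real.exp (s * 3) := by gcongr
    _ = Real.exp (s * (4 + Real.log (N / s))) := by
        rw [← Real.exp_add]
        ring_nf

lemma measureReal_not_satisfiesRIP_le (hind : iIndepFun ξ μ) (hK : 1 ≤ K)
    (hsub : ∀ i, HasSubgaussianMGF (ξ i) (K / Fintype.card R) μ)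
    (hvar : ∀ i, Var[ξ i; μ] = 1 / Fintype.card R) {φ : R → κ → ι}
    (hφ : ∀ r, Function.Injective (φ r)) {s q : ℕ} (hs0 : 0 < s) (hs : s ≤ Fintype.card κ)
    (hq : ∀ S : Finset κ, S.card = s → (conflictGraph fun r (t : S) => φ r t).Colorable q)
    (hδ0 : 0 ≤ δ) (hδ1 : δ ≤ 1) :
    μ.real {ω | ¬SatisfiesRIP (patternMatrix φ (ξ · ω)) s δ} ≤
      Real.exp (s * (4 + Real.log (Fintype.card κ / s)) -
        concentrationRate δ K * Fintype.card R / q) := by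
  have := hind.isProbabilityMeasure
  let bad (S : Finset κ) : Set Ω := {ω | ¬∀ z : EuclideanSpace ℝ S,
    |‖WithLp.toLp 2 ((patternMatrix (fun r (t : S) => φ r t) (ξ · ω)).mulVec z.ofLp)‖ ^ 2 -
      ‖z‖ ^ 2| ≤ δ * ‖z‖ ^ 2}
  have hbad (S : Finset κ) (hS : S ∈ Finset.univ.powersetCard s) : μ.real (bad S) ≤
      5 ^ s * (2 * Real.exp (-(concentrationRate δ K * Fintype.card R / q))) := by
    have hSs : S.card = s := (Finset.mem_powersetCard.1 hS).2
    have h := measureReal_not_forall_abs_norm_sq_sub_norm_sq_le hind hK hsub hvar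
      (fun r => (hφ r).comp Subtype.val_injective) (hq S hSs) hδ0 hδ1
    rwa [Fintype.card_coe, hSs] at h
  calc _ ≤ μ.real (⋃ S ∈ Finset.univ.powersetCard s, bad S) := by
        refine measureReal_mono (fun ω hω => ?_) (measure_ne_top _ _)
        contrapose! hω
        refine not_not.2 (satisfiesRIP_of_card_eq hs fun S hS => ?_)
        exact not_not.1 fun h => hω (Set.mem_biUnion (by simpa using hS) h)
    _ ≤ ∑ S ∈ Finset.univ.powersetCard s, μ.real (bad S) := measureReal_biUnion_finset_le _ _
    _ ≤ _ := Finset.sum_le_card_nsmul _ _ _ hbad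
    _ = (Fintype.card κ).choose s * (5 ^ s * 2) *
          Real.exp (-(concentrationRate δ K * Fintype.card R / q)) := by
        rw [Finset.card_powersetCard, Finset.card_univ, nsmul_eq_mul]
        ring
    _ ≤ _ := by
        rw [sub_eq_add_neg, Real.exp_add]
        gcongr
        exact choose_mul_five_pow_le_exp hs0 hs

lemma one_sub_exp_le_measureReal_satisfiesRIP (hind : iIndepFun ξ μ) (hK : 1 ≤ K)
    (hsub : ∀ i, HasSubgaussianMGF (ξ i) (K / Fintype.card R) μ)
    (hvar : ∀ i, Var[ξ i; μ] = 1 / Fintype.card R) {φ : R → κ → ι}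
    (hφ : ∀ r, Function.Injective (φ r)) {s q : ℕ} (hs0 : 0 < s) (hs : s ≤ Fintype.card κ)
    (hq : ∀ S : Finset κ, S.card = s → (conflictGraph fun r (t : S) => φ r t).Colorable q)
    (hδ0 : 0 ≤ δ) (hδ1 : δ ≤ 1)
    (hR : s * (4 + Real.log (Fintype.card κ / s)) ≤
      concentrationRate δ K * Fintype.card R / (2 * q)) :
    1 - Real.exp (-(concentrationRate δ K * Fintype.card R / (2 * q))) ≤
      μ.real {ω | SatisfiesRIP (patternMatrix φ (ξ · ω)) s δ} := by
  have := hind.isProbabilityMeasure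
  have hcover : 1 ≤ μ.real {ω | SatisfiesRIP (patternMatrix φ (ξ · ω)) s δ} +
      μ.real {ω | ¬SatisfiesRIP (patternMatrix φ (ξ · ω)) s δ} := by
    rw [← probReal_univ (μ := μ),
      ← Set.union_compl_self {ω | SatisfiesRIP (patternMatrix φ (ξ · ω)) s δ}]
    exact measureReal_union_le _ _
  have hfail := measureReal_not_satisfiesRIP_le hind hK hsub hvar hφ hs0 hs hq hδ0 hδ1
  have hexp : s * (4 + Real.log (Fintype.card κ / s)) -
      concentrationRate δ K * Fintype.card R / q ≤
        -(concentrationRate δ K * Fintype.card R / (2 * q)) := by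
    rw [mul_comm (2 : ℝ), ← div_div] at hR ⊢
    linarith
  linarith [Real.exp_le_exp.2 hexp]

end Concentration

section Toeplitz

variable {k l d e : ℕ}

/-- The pattern of the truncated Toeplitz block matrix: the number of the block, and the position
in it, of the entry in row `p` and column `t`. -/
def toeplitzIndex (p : Fin l × Fin d) (t : Fin k × Fin e) : Fin (k + l - 1) × Fin d × Fin e :=
  (⟨p.1 + (k - 1 - t.1), by have := p.1.isLt; have := t.1.isLt; omega⟩, p.2, t.2)

lemma toeplitzIndex_right_injective (p : Fin l × Fin d) :
    Function.Injective (toeplitzIndex p : Fin k × Fin e → _) := by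
  rintro ⟨j, b⟩ ⟨j', b'⟩ h
  simp only [toeplitzIndex, Prod.mk.injEq, Fin.mk.injEq, true_and] at h
  exact Prod.ext (Fin.ext (by simp only; omega)) h.2

lemma toeplitzIndex_left_injective (t : Fin k × Fin e) :
    Function.Injective fun p : Fin l × Fin d => toeplitzIndex p t := by
  rintro ⟨i, a⟩ ⟨i', a'⟩ h
  simp only [toeplitzIndex, Prod.mk.injEq, Fin.mk.injEq, and_true] at h
  exact Prod.ext (Fin.ext (by simp only; omega)) h.2

lemma conflictGraph_toeplitzIndex_colorable (S : Finset (Fin k × Fin e)) :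
    (conflictGraph fun (p : Fin l × Fin d) (t : S) => toeplitzIndex p t.1).Colorable l := by
  refine ⟨SimpleGraph.Coloring.mk Prod.fst ?_⟩
  rintro p p' ⟨hne, t, t', h⟩ hp
  exact hne (Prod.ext hp (congrArg (fun x => x.2.1) h))

lemma three_mul_mul_four_add_log_le {m N : ℕ} (hm : 1 ≤ m) (hN : 3 * m ≤ N) :
    (3 * m : ℕ) * (4 + Real.log (N / (3 * m : ℕ))) ≤ 12 * (m * Real.log (N / m)) := by
  have hm' : (0 : ℝ) < m := by exact_mod_cast hm
  have hN' : (3 * m : ℝ) ≤ N := by exact_mod_cast hN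
  have hN0 : (0 : ℝ) < N := by linarith
  have hlog3 : 1 ≤ Real.log 3 :=
    (Real.le_log_iff_exp_le (by norm_num)).2 (Real.exp_one_lt_d9.le.trans (by norm_num))
  have hlog : Real.log 3 ≤ Real.log (N / m) :=
    Real.log_le_log (by norm_num) ((le_div_iff₀ hm').2 hN')
  have hsplit : Real.log (N / (3 * m : ℕ)) = Real.log (N / m) - Real.log 3 := by
    rw [← Real.log_div (by positivity) (by norm_num), div_div, mul_comm (m : ℝ)]
    push_cast
    rfl
  calc (3 * m : ℕ) * (4 + Real.log (N / (3 * m : ℕ)))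
      = 3 * (m * (4 + Real.log (N / m) - Real.log 3)) := by
        rw [hsplit]
        push_cast
        ring
    _ ≤ 3 * (m * (4 * Real.log (N / m))) := by
        gcongr
        linarith
    _ = 12 * (m * Real.log (N / m)) := by ring

variable {Ω : Type*} {mΩ : MeasurableSpace Ω} {μ : Measure Ω}
  {Φ : Fin (k + l - 1) → Fin d → Fin e → Ω → ℝ} {K : ℝ≥0} {δ : ℝ}

lemma one_sub_exp_le_measureReal_toeplitzBlock_satisfiesRIP {n N m q : ℕ} (hn0 : n ≠ 0)
    (hn : n = l * d) (hN : N = k * e) (hm : 1 ≤ m) (hmN : 3 * m ≤ N)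
    (hind : iIndepFun (fun t : Fin (k + l - 1) × Fin d × Fin e => Φ t.1 t.2.1 t.2.2) μ)
    (hK : 1 ≤ K) (hsub : ∀ t a b, HasSubgaussianMGF (Φ t a b) (K / n) μ)
    (hvar : ∀ t a b, Var[Φ t a b; μ] = 1 / n) (hδ0 : 0 ≤ δ) (hδ1 : δ ≤ 1)
    (hq : ∀ S : Finset (Fin k × Fin e), S.card = 3 * m →
      (conflictGraph fun (p : Fin l × Fin d) (t : S) => toeplitzIndex p t.1).Colorable q)
    (hlog : 12 * (m * Real.log (N / m)) ≤ concentrationRate δ K * n / (2 * q)) :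
    1 - Real.exp (-(concentrationRate δ K * n / (2 * q))) ≤
      μ.real {ω | SatisfiesRIP (toeplitzBlock fun t => Matrix.of fun a b => Φ t a b ω)
        (3 * m) δ} := by
  have hcardR : Fintype.card (Fin l × Fin d) = n := by simp [hn]
  have hcardκ : Fintype.card (Fin k × Fin e) = N := by simp [hN]
  have : Nonempty (Fin l × Fin d) := Fintype.card_pos_iff.1 (by omega)
  have h := one_sub_exp_le_measureReal_satisfiesRIP hind hK (fun t => hcardR ▸ hsub _ _ _)
    (fun t => hcardR ▸ hvar _ _ _) toeplitzIndex_right_injective (by omega) (hcardκ ▸ hmN) hq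
    hδ0 hδ1 (by
      rw [hcardR, hcardκ]
      exact (three_mul_mul_four_add_log_le hm hmN).trans hlog)
  rw [hcardR] at h
  exact h

lemma one_sub_exp_le_measureReal_toeplitzBlock_satisfiesRIP_of_le {n N m q : ℕ} {Q : ℝ}
    (hn0 : n ≠ 0) (hn : n = l * d) (hN : N = k * e) (hm : 1 ≤ m) (hmN : 3 * m ≤ N)
    (hind : iIndepFun (fun t : Fin (k + l - 1) × Fin d × Fin e => Φ t.1 t.2.1 t.2.2) μ)
    (hK : 1 ≤ K) (hsub : ∀ t a b, HasSubgaussianMGF (Φ t a b) (K / n) μ)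
    (hvar : ∀ t a b, Var[Φ t a b; μ] = 1 / n) (hδ0 : 0 < δ) (hδ1 : δ ≤ 1)
    (hq : ∀ S : Finset (Fin k × Fin e), S.card = 3 * m →
      (conflictGraph fun (p : Fin l × Fin d) (t : S) => toeplitzIndex p t.1).Colorable q)
    (hq0 : 0 < q) (hqQ : q ≤ 9 * Q)
    (hlog : 216 / concentrationRate δ K * Q * m * Real.log (N / m) ≤ n) :
    1 - Real.exp (-(concentrationRate δ K / 18) * n / Q) ≤
      μ.real {ω | SatisfiesRIP (toeplitzBlock fun t => Matrix.of fun a b => Φ t a b ω)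
        (3 * m) δ} := by
  have hq0' : (0 : ℝ) < q := by exact_mod_cast hq0
  have hQ : 0 < Q := by linarith
  have hrate : 0 < concentrationRate δ K := concentrationRate_pos hδ0.ne' (by positivity)
  have hexponent : concentrationRate δ K / 18 * n / Q ≤ concentrationRate δ K * n / (2 * q) := by
    rw [div_mul_eq_mul_div, div_div]
    exact div_le_div_of_nonneg_left (by positivity) (by positivity) (by linarith)
  have hlog' : 12 * (m * Real.log (N / m)) ≤ concentrationRate δ K / 18 * n / Q := by
    rw [div_mul_eq_mul_div, div_mul_eq_mul_div, div_mul_eq_mul_div, div_le_iff₀ hrate] at hlog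
    rw [le_div_iff₀ hQ]
    linarith
  refine le_trans ?_ (one_sub_exp_le_measureReal_toeplitzBlock_satisfiesRIP hn0 hn hN hm hmN hind
    hK hsub hvar hδ0.le hδ1 hq (hlog'.trans hexponent))
  rw [neg_mul, neg_div]
  gcongr

end Toeplitz

section EntryLaw

variable {Ω : Type*} {mΩ : MeasurableSpace Ω} {μ : Measure Ω} {X : Ω → ℝ}

lemma integral_bernoulli_law (n : ℕ) (g : ℝ → ℝ) :
    ∫ x, g x ∂(EntryDistribution.bernoulli.law n) =
      1 / 2 * g (1 / √(n : ℝ)) + 1 / 2 * g (-(1 / √(n : ℝ))) := by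
  have hint (a : ℝ) : Integrable g ((1 / 2 : ℝ≥0∞) • Measure.dirac a) :=
    (integrable_dirac (by simp)).smul_measure (by simp)
  rw [EntryDistribution.law, integral_add_measure (hint _) (hint _)]
  simp [integral_smul_measure]

lemma integral_ternary_law (n : ℕ) (g : ℝ → ℝ) :
    ∫ x, g x ∂(EntryDistribution.ternary.law n) =
      1 / 6 * g (√(3 / (n : ℝ))) + 2 / 3 * g 0 + 1 / 6 * g (-√(3 / (n : ℝ))) := by
  have hint (a : ℝ) {c : ℝ≥0∞} (hc : c ≠ ∞) : Integrable g (c • Measure.dirac a) :=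
    (integrable_dirac (by simp)).smul_measure hc
  have h6 : (1 / 6 : ℝ≥0∞) ≠ ∞ := by simp
  have h3 : (2 / 3 : ℝ≥0∞) ≠ ∞ := ENNReal.div_ne_top (by simp) (by simp)
  rw [EntryDistribution.law, integral_add_measure ((hint _ h6).add_measure (hint _ h3))
    (hint _ h6), integral_add_measure (hint _ h6) (hint _ h3)]
  simp [integral_smul_measure]

lemma integral_id_law (P : EntryDistribution) (n : ℕ) : ∫ x, x ∂(P.law n) = 0 := by
  cases P with
  | gaussian => exact integral_id_gaussianReal
  | bernoulli =>
    rw [integral_bernoulli_law]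
    ring
  | ternary =>
    rw [integral_ternary_law]
    ring

lemma variance_id_law (P : EntryDistribution) (n : ℕ) : Var[id; P.law n] = 1 / n := by
  have hsq : Var[id; P.law n] = ∫ x, x ^ 2 ∂(P.law n) :=
    variance_of_integral_eq_zero aemeasurable_id (integral_id_law P n)
  cases P with
  | gaussian => simp [EntryDistribution.law]
  | bernoulli =>
    rw [hsq, integral_bernoulli_law, neg_sq, div_pow, Real.sq_sqrt (by positivity)]
    ring
  | ternary =>
    rw [hsq, integral_ternary_law, neg_sq, Real.sq_sqrt (by positivity)]
    ring

lemma isProbabilityMeasure_law (P : EntryDistribution) (n : ℕ) :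
    IsProbabilityMeasure (P.law n) := by
  rw [isProbabilityMeasure_iff_real]
  suffices h : ∫ _, (1 : ℝ) ∂(P.law n) = 1 by simpa using h
  cases P with
  | gaussian => simp [EntryDistribution.law]
  | bernoulli =>
    rw [integral_bernoulli_law]
    norm_num
  | ternary =>
    rw [integral_ternary_law]
    norm_num

lemma hasSubgaussianMGF_id_gaussianReal (v : ℝ≥0) :
    HasSubgaussianMGF id v (gaussianReal 0 v) where
  integrable_exp_mul t := integrable_exp_mul_gaussianReal t
  mgf_le t := by simp [mgf_id_gaussianReal]

lemma ae_law_mem_Icc {P : EntryDistribution} (hP : P ≠ .gaussian) (n : ℕ) :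
    ∀ᵐ x ∂(P.law n), x ∈ Set.Icc (-√(3 / (n : ℝ))) (√(3 / (n : ℝ))) := by
  have hdirac {a : ℝ} (ha : |a| ≤ √(3 / (n : ℝ))) (p : ℝ≥0∞) :
      ∀ᵐ x ∂(p • Measure.dirac a), x ∈ Set.Icc (-√(3 / (n : ℝ))) (√(3 / (n : ℝ))) :=
    Measure.ae_smul_measure (by simpa [ae_dirac_eq] using abs_le.1 ha) p
  have hbernoulli : |1 / √(n : ℝ)| ≤ √(3 / (n : ℝ)) := by
    rw [abs_of_nonneg (by positivity), Real.sqrt_div (by norm_num)]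
    gcongr
    exact Real.one_le_sqrt.2 (by norm_num)
  have hternary : |√(3 / (n : ℝ))| ≤ √(3 / (n : ℝ)) := (abs_of_nonneg (Real.sqrt_nonneg _)).le
  cases P with
  | gaussian => exact absurd rfl hP
  | bernoulli =>
    exact ae_add_measure_iff.2 ⟨hdirac hbernoulli _, hdirac (by rwa [abs_neg]) _⟩
  | ternary =>
    exact ae_add_measure_iff.2 ⟨ae_add_measure_iff.2
      ⟨hdirac hternary _, hdirac (abs_zero.trans_le (Real.sqrt_nonneg _)) _⟩,
      hdirac (by rwa [abs_neg]) _⟩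

lemma hasSubgaussianMGF_id_law (P : EntryDistribution) (n : ℕ) :
    HasSubgaussianMGF id (3 / n) (P.law n) := by
  have := isProbabilityMeasure_law P n
  by_cases hP : P = .gaussian
  · subst hP
    have h := hasSubgaussianMGF_id_gaussianReal (1 / (n : ℝ≥0))
    have hle : 1 / (n : ℝ≥0) ≤ 3 / n := by
      gcongr
      norm_num
    exact ⟨h.integrable_exp_mul, fun t => (h.mgf_le t).trans (by gcongr)⟩
  · convert hasSubgaussianMGF_of_mem_Icc_of_integral_eq_zero aemeasurable_id (ae_law_mem_Icc hP n)
      (integral_id_law P n)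
    refine NNReal.eq ?_
    push_cast
    rw [sub_neg_eq_add, Real.norm_of_nonneg (by positivity), add_self_div_two,
      Real.sq_sqrt (by positivity)]

lemma hasSubgaussianMGF_of_hasLaw {P : EntryDistribution} {n : ℕ} (hX : HasLaw X (P.law n) μ) :
    HasSubgaussianMGF X (3 / n) μ :=
  (HasSubgaussianMGF.id_map_iff hX.aemeasurable).1 (hX.map_eq ▸ hasSubgaussianMGF_id_law P n)

lemma variance_eq_of_hasLaw {P : EntryDistribution} {n : ℕ} (hX : HasLaw X (P.law n) μ) :
    Var[X; μ] = 1 / n :=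
  hX.variance_eq.trans (variance_id_law P n)

end EntryLaw

theorem theorem1_general (δ : ℝ) (hδ0 : 0 < δ) (hδ1 : δ < 1) (K : ℝ≥0) (hK : 1 ≤ K) :
    ∃ c₁ c₂ : ℝ, 0 < c₁ ∧ 0 < c₂ ∧ ∀ (m k l d e n N : ℕ), 1 ≤ m →
      n = l * d → N = k * e → 3 * m ≤ N →
      ∀ (Ω : Type*) [MeasurableSpace Ω] (μ : Measure Ω)
        (Φ : Fin (k + l - 1) → Fin d → Fin e → Ω → ℝ),
        iIndepFun (fun t : Fin (k + l - 1) × Fin d × Fin e => Φ t.1 t.2.1 t.2.2) μ →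
        (∀ t a b, HasSubgaussianMGF (Φ t a b) (K / n) μ) →
        (∀ t a b, Var[Φ t a b; μ] = 1 / n) →
        (c₁ * l * m * Real.log ((N : ℝ) / m) ≤ n →
          1 - Real.exp (-c₂ * n / l) ≤
            μ.real {ω | SatisfiesRIP (toeplitzBlock fun t => Matrix.of fun a b => Φ t a b ω)
              (3 * m) δ}) ∧
        (c₁ * (m : ℝ) ^ 3 * Real.log ((N : ℝ) / m) ≤ n →
          1 - Real.exp (-c₂ * n / (m : ℝ) ^ 2) ≤
            μ.real {ω | SatisfiesRIP (toeplitzBlock fun t => Matrix.of fun a b => Φ t a b ω)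
              (3 * m) δ}) := by
  have hrate : 0 < concentrationRate δ K := concentrationRate_pos hδ0.ne' (by positivity)
  refine ⟨216 / concentrationRate δ K, concentrationRate δ K / 18, by positivity, by positivity,
    fun m k l d e n N hm hn hN hmN Ω _ μ Φ hind hsub hvar => ?_⟩
  rcases eq_or_ne n 0 with hn0 | hn0
  · simp [hn0]
  have hl0 : 0 < l := Nat.pos_of_ne_zero (by rintro rfl; simp [hn] at hn0)
  constructor <;> intro hlog
  · exact one_sub_exp_le_measureReal_toeplitzBlock_satisfiesRIP_of_le hn0 hn hN hm hmN hind hK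
      hsub hvar hδ0 hδ1.le (fun S _ => conflictGraph_toeplitzIndex_colorable S) hl0
      (by linarith [(Nat.cast_nonneg l : (0 : ℝ) ≤ l)]) hlog
  · have hcolor (S : Finset (Fin k × Fin e)) (hS : S.card = 3 * m) :
        (conflictGraph fun (p : Fin l × Fin d) (t : S) => toeplitzIndex p t.1).Colorable
          (3 * m * (3 * m - 1) + 1) := by
      have h := conflictGraph_colorable fun t : S =>
        toeplitzIndex_left_injective (l := l) (d := d) t.1
      rwa [Fintype.card_coe, hS] at h
    have hcard : 3 * m * (3 * m - 1) + 1 ≤ 9 * m ^ 2 := by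
      obtain ⟨j, rfl⟩ := Nat.exists_eq_add_of_le hm
      rw [show 3 * (1 + j) - 1 = 3 * j + 2 by omega]
      nlinarith
    refine one_sub_exp_le_measureReal_toeplitzBlock_satisfiesRIP_of_le hn0 hn hN hm hmN hind hK
      hsub hvar hδ0 hδ1.le hcolor (Nat.succ_pos _) (by exact_mod_cast hcard) ?_
    rwa [mul_assoc _ ((m : ℝ) ^ 2), ← pow_succ]

theorem theorem1 (δ : ℝ) (hδ0 : 0 < δ) (hδ1 : δ < 1) :
    ∃ c₁ c₂ : ℝ, 0 < c₁ ∧ 0 < c₂ ∧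
      ∀ (P : EntryDistribution) (m k l d e n N : ℕ),
        1 ≤ m → 1 ≤ l → n = l * d → N = k * e → 3 * m ≤ N →
      ∀ (Ω : Type*) [MeasurableSpace Ω] (μ : Measure Ω) [IsProbabilityMeasure μ]
        (Φ : Fin (k + l - 1) → Fin d → Fin e → Ω → ℝ),
        iIndepFun (fun t : Fin (k + l - 1) × Fin d × Fin e => Φ t.1 t.2.1 t.2.2) μ →
        (∀ t a b, HasLaw (Φ t a b) (P.law n) μ) →
        (l ≤ 3 * m * (3 * m - 1) →
          c₁ * l * m * Real.log ((N : ℝ) / m) ≤ n →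
          1 - Real.exp (-c₂ * n / l) ≤
            μ.real {ω | SatisfiesRIP
              (toeplitzBlock fun t => Matrix.of fun a b => Φ t a b ω) (3 * m) δ}) ∧
        (3 * m * (3 * m - 1) < l →
          c₁ * (m : ℝ) ^ 3 * Real.log ((N : ℝ) / m) ≤ n →
          1 - Real.exp (-c₂ * n / (m : ℝ) ^ 2) ≤
            μ.real {ω | SatisfiesRIP
              (toeplitzBlock fun t => Matrix.of fun a b => Φ t a b ω) (3 * m) δ}) := by
  obtain ⟨c₁, c₂, hc₁, hc₂, h⟩ := theorem1_general δ hδ0 hδ1 3 (by norm_num)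
  refine ⟨c₁, c₂, hc₁, hc₂, fun P m k l d e n N hm _ hn hN hmN Ω _ μ _ Φ hind hlaw => ?_⟩
  have hRIP := h m k l d e n N hm hn hN hmN Ω μ Φ hind
    (fun t a b => hasSubgaussianMGF_of_hasLaw (hlaw t a b))
    (fun t a b => variance_eq_of_hasLaw (hlaw t a b))
  exact ⟨fun _ => hRIP.1, fun _ => hRIP.2⟩
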